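/- A first-order method $\mathcal{M} = (\mathcal{M}_0, \mathcal{M}_1, \ldots)$ on $\mathbb{R}^d$ is a sequence of arbitrary mappings. Applied to a differentiable function $f : \mathbb{R}^d \to \mathbb{R}$, it starts at $x_0 = 0$ and generates $$x_{k+1} = \mathcal{M}_k\big((f(x_0), \nabla f(x_0)), \ldots, (f(x_k), \nabla f(x_k))\big), \qquad k \geq 0.$$ Let $r > 0$, $s > 0$, $\mu > 0$, $L > \mu$, and let $N, d$ be integers with $1 \leq N \leq \frac{d-1}{2}$. Then for every first-order method on $\mathbb{R}^d$ there is a strongly convex quadratic function $$f(x) = \tfrac12 x^\top A x - b^\top x + \tfrac{s}{2}\|x\|^2, \qquad x \in \mathbb{R}^d,$$ where $\|\cdot\|$ is the Euclidean norm, $b \in \mathbb{R}^d$, and $A \in \mathbb{R}^{d \times d}$ is symmetric positive semidefinite with $\lambda_{\min}(A) = \mu$ and $\lambda_{\max}(A) = L$, such that the unique minimizer $x_\star$ of $f$ satisfies $\|x_\star\| = r$ and, with $f_\star = f(x_\star)$, the $N$-th iterate $x_N$ of the method applied to $f$ satisfies both $$f(x_N) - f_\star \;\geq\; s r^2 \exp\Big(-\frac{16N}{\sqrt{Q_\star}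 - 1}\Big) \qquad\text{and}\qquad \|\nabla f(x_N)\| \;\geq\; s r \exp\Big(-\frac{8N}{\sqrt{Q_\star} - 1}\Big),$$ where $Q_\star = \frac{L+s}{\mu+s}$. -/

import Mathlib

noncomputable section

/-- A first-order method on `ℝ^d` : the `k`-th mapping produces the iterate `x_{k+1}` from the
oracle answers (function value, gradient) at the points `x_0, …, x_k`. The mappings are arbitrary. -/
def FirstOrderMethod (d : ℕ) : Type :=
  (k : ℕ) → (Fin (k + 1) → ℝ × EuclideanSpace ℝ (Fin d)) → EuclideanSpace ℝ (Fin d)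

/-- The first-order black-box oracle: the function value and the gradient at a point. -/
def firstOrderOracle {d : ℕ} (f : EuclideanSpace ℝ (Fin d) → ℝ) (x : EuclideanSpace ℝ (Fin d)) :
    ℝ × EuclideanSpace ℝ (Fin d) :=
  (f x, gradient f x)

/-- The trajectory of the method `M` applied to `f`: it starts at `x_0 = 0`, and `x_{k+1}` is
computed by the `k`-th mapping from the oracle answers at `x_0, …, x_k`. -/
def FirstOrderMethod.iterate {d : ℕ} (M : FirstOrderMethod d)
    (f : EuclideanSpace ℝ (Fin d) → ℝ) : ℕ → EuclideanSpace ℝ (Fin d)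
  | 0 => 0
  | k + 1 => M k (fun i : Fin (k + 1) => firstOrderOracle f (FirstOrderMethod.iterate M f i.val))
termination_by k => k
decreasing_by exact i.isLt

theorem FirstOrderMethod.iterate_zero {d : ℕ} (M : FirstOrderMethod d)
    (f : EuclideanSpace ℝ (Fin d) → ℝ) : M.iterate f 0 = 0 := by
  rw [FirstOrderMethod.iterate]

theorem FirstOrderMethod.iterate_succ {d : ℕ} (M : FirstOrderMethod d)
    (f : EuclideanSpace ℝ (Fin d) → ℝ) (k : ℕ) :
    M.iterate f (k + 1) =
      M k (fun i : Fin (k + 1) => firstOrderOracle f (M.iterate f i.val)) := by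
  rw [FirstOrderMethod.iterate]

/-- The regularized quadratic function with power two,
`f(x) = (1/2) xᵀ A x - bᵀ x + (s/2) ‖x‖²`, with the Euclidean norm. -/
def regQuadratic {d : ℕ} (A : Matrix (Fin d) (Fin d) ℝ) (b : EuclideanSpace ℝ (Fin d)) (s : ℝ)
    (x : EuclideanSpace ℝ (Fin d)) : ℝ :=
  1 / 2 * inner ℝ x (Matrix.toEuclideanLin A x) - inner ℝ b x + s / 2 * ‖x‖ ^ 2

/-- The modified condition number `(L + s) / (μ + s)`. -/
def modifiedConditionNumber (μ L s : ℝ) : ℝ := (L + s) / (μ + s)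

end

/-! Put `m = μ + s` and `K = L + s`, the extreme eigenvalues of the Hessian `H = A + s I`. If an
iterate equals `p(H) b`, its error is `-(1 - X p)(H) z`, where `z` is the minimizer and `b = H z`.
The residual polynomial takes the value 1 at 0, so it cannot be small at all points of a set from
which extrapolation to 0 is stable. `exists_extrapolation_nodes` provides Chebyshev nodes in `[a,
K]` whose extrapolation weights `c i` sum to a value of a Chebyshev polynomial. With these nodes as
eigenvalues and `z i ^ 2` proportional to `c i`, Cauchy–Schwarz (`sq_div_le_sum_weight_mul_sq`)
bounds the gap below.

An arbitrary method need not stay in Krylov subspaces. A resisting oracle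
(`exists_isometry_forall_iterate_mem`) rotates the quadratic so that each iterate leaves the
subspace generated so far in one prescribed direction only. That direction and the new gradient cost
two Krylov dimensions per step. The last direction is an eigenvector inactive in `b`, hence useless
to the method; this is why `2 * N` active eigenvalues and one inactive one, `d ≥ 2 * N + 1`,
suffice.

The gradient bound follows from the gap by the Polyak–Łojasiewicz inequality. -/

open Polynomial

/-! ### Chebyshev extrapolation. -/

/-- The value at `x` of the Lagrange basis polynomials of the Chebyshev extremal nodes, in absolute
value for `x ≥ 1`. -/
noncomputable def chebyshevWeight (k : ℕ) (x : ℝ) (i : ℕ) : ℝ :=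
  (∏ j ∈ (Finset.range (k + 1)).erase i, (x - Chebyshev.node k j)) /
    ((-1) ^ i * ∏ j ∈ (Finset.range (k + 1)).erase i, (Chebyshev.node k i - Chebyshev.node k j))

theorem chebyshevWeight_pos {k i : ℕ} {x : ℝ} (hi : i ≤ k) (hx : 1 < x) :
    0 < chebyshevWeight k x i := by
  refine div_pos (Finset.prod_pos fun j _ => ?_) (Chebyshev.zero_lt_prod_node_sub_node hi)
  have := (Chebyshev.node_mem_Icc (n := k) (i := j)).2
  linarith

theorem eval_eq_sum_chebyshevWeight {k : ℕ} (x : ℝ) {p : ℝ[X]} (hp : p.natDegree ≤ k) :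
    p.eval x = ∑ i ∈ Finset.range (k + 1),
      chebyshevWeight k x i * ((-1) ^ i * p.eval (Chebyshev.node k i)) := by
  have hinj : Set.InjOn (Chebyshev.node k) (Finset.range (k + 1)) :=
    (Chebyshev.strictAntiOn_node k).injOn
  have hdeg : p.degree < (Finset.range (k + 1)).card := by
    rw [Finset.card_range]
    exact lt_of_le_of_lt degree_le_natDegree (by exact_mod_cast Nat.lt_succ_of_le hp)
  conv_lhs => rw [Lagrange.eq_interpolate hinj hdeg]
  rw [Lagrange.interpolate_apply, eval_finsetSum]
  refine Finset.sum_congr rfl fun i _ => ?_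
  have hs : ((-1 : ℝ) ^ i) ≠ 0 := by positivity
  rw [eval_mul, eval_C, Lagrange.basis, eval_prod, chebyshevWeight]
  simp only [Lagrange.basisDivisor, eval_mul, eval_C, eval_sub, eval_X, Finset.prod_mul_distrib,
    Finset.prod_inv_distrib]
  rw [div_eq_mul_inv, mul_inv]
  field_simp

/-- `T k` equals `(-1) ^ i` at the `i`-th node, so every signed value in the interpolation formula
is 1. -/
theorem sum_chebyshevWeight (k : ℕ) (x : ℝ) :
    ∑ i ∈ Finset.range (k + 1), chebyshevWeight k x i = (Chebyshev.T ℝ k).eval x := by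
  rw [eval_eq_sum_chebyshevWeight (k := k) x (p := Chebyshev.T ℝ k)
    (by simp [Chebyshev.natDegree_T])]
  refine Finset.sum_congr rfl fun i hi => ?_
  rw [Chebyshev.eval_T_real_node (by simpa [Nat.lt_succ_iff] using hi), ← mul_pow]
  simp

theorem eval_T_half_add_inv_le (k : ℕ) {q : ℝ} (hq : 1 ≤ q) :
    (Chebyshev.T ℝ k).eval ((q + q⁻¹) / 2) ≤ q ^ k := by
  have hq0 : 0 < q := by linarith
  have h := Chebyshev.T_real_cosh (Real.log q) k
  rw [Real.cosh_log hq0] at h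
  have h0 : 0 ≤ Real.log q := Real.log_nonneg hq
  have hle : Real.cosh ((k : ℤ) * Real.log q) ≤ Real.exp (k * Real.log q) := by
    rw [Real.cosh_eq]
    have : Real.exp (-((k : ℤ) * Real.log q)) ≤ Real.exp (k * Real.log q) := by
      apply Real.exp_le_exp.2
      have : 0 ≤ (k : ℝ) * Real.log q := by positivity
      push_cast; linarith
    push_cast at this ⊢
    linarith
  rw [h]
  refine hle.trans (le_of_eq ?_)
  rw [mul_comm, Real.exp_mul, Real.exp_log hq0, Real.rpow_natCast]

/-- Nodes in `[a, M]` for which extrapolation to `0` of polynomials of degree at most `k` has a small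
Lebesgue constant. -/
theorem exists_extrapolation_nodes {a M : ℝ} (ha : 0 < a) (haM : a < M) {k : ℕ} (hk : 1 ≤ k) :
    ∃ lam c : ℕ → ℝ, Set.InjOn lam (Finset.range (k + 1)) ∧
      (∀ i, a ≤ lam i ∧ lam i ≤ M) ∧ lam k = M ∧ (∀ i ≤ k, 0 < c i) ∧
      (∀ p : ℝ[X], p.natDegree ≤ k →
        |p.eval 0| ≤ ∑ i ∈ Finset.range (k + 1), c i * |p.eval (lam i)|) ∧
      ∑ i ∈ Finset.range (k + 1), c i ≤ Real.exp (2 * k / (Real.sqrt (M / a) - 1)) := by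
  have hMa : 0 < M - a := by linarith
  have hx : 1 < (M + a) / (M - a) := by rw [lt_div_iff₀ hMa]; linarith
  -- The decreasing affine map taking `[-1, 1]` onto `[a, M]` sends `(M + a) / (M - a)` to 0 and the
  -- last node `-1` to `M`.
  refine ⟨fun i => (M + a) / 2 - (M - a) / 2 * Chebyshev.node k i,
    chebyshevWeight k ((M + a) / (M - a)), ?_, ?_, ?_, fun i hi => chebyshevWeight_pos hi hx, ?_, ?_⟩
  · intro i hi j hj hij
    refine (Chebyshev.strictAntiOn_node k).injOn hi hj ?_
    have : (M - a) / 2 * Chebyshev.node k i = (M - a) / 2 * Chebyshev.node k j := by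
      simp only at hij; linarith
    exact mul_left_cancel₀ (by linarith) this
  · intro i
    obtain ⟨h1, h2⟩ := Chebyshev.node_mem_Icc (n := k) (i := i)
    constructor <;> nlinarith
  · simp only [Chebyshev.node_eq_neg_one (show k ≠ 0 by omega)]; ring
  · intro p hp
    have hd : (p.comp (C ((M + a) / 2) - C ((M - a) / 2) * X)).natDegree ≤ k := by
      refine natDegree_comp_le.trans ?_
      have : (C ((M + a) / 2) - C ((M - a) / 2) * X).natDegree ≤ 1 := by compute_degree
      nlinarith
    have h := eval_eq_sum_chebyshevWeight ((M + a) / (M - a)) hd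
    have h0 : (M + a) / 2 - (M - a) / 2 * ((M + a) / (M - a)) = 0 := by field_simp; ring
    simp only [eval_comp, eval_sub, eval_mul, eval_C, eval_X, h0] at h
    rw [h]
    refine (Finset.abs_sum_le_sum_abs _ _).trans (le_of_eq (Finset.sum_congr rfl fun i hi => ?_))
    rw [abs_mul, abs_mul, abs_neg_one_pow, one_mul,
      abs_of_pos (chebyshevWeight_pos (by simpa [Nat.lt_succ_iff] using hi) hx)]
  · rw [sum_chebyshevWeight]
    set t := Real.sqrt (M / a) with ht
    have ht1 : 1 < t := by
      rw [ht, Real.lt_sqrt (by norm_num), one_pow, lt_div_iff₀ ha]; linarith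
    have hM : M = a * t ^ 2 := by
      rw [ht, Real.sq_sqrt (div_nonneg (ha.trans haM).le ha.le)]; field_simp
    have ht0 : t - 1 ≠ 0 := by linarith
    have ht2 : t + 1 ≠ 0 := by linarith
    have ht3 : t ^ 2 - 1 ≠ 0 := by nlinarith
    have hq : (M + a) / (M - a) = ((t + 1) / (t - 1) + ((t + 1) / (t - 1))⁻¹) / 2 := by
      have : a * t ^ 2 - a ≠ 0 := by rw [← hM]; exact hMa.ne'
      rw [hM, show a * t ^ 2 - a = a * ((t - 1) * (t + 1)) by ring]
      field_simp
      ring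
    have hq1 : 1 ≤ (t + 1) / (t - 1) := by rw [le_div_iff₀ (by linarith)]; linarith
    rw [hq]
    refine (eval_T_half_add_inv_le k hq1).trans ?_
    have : (t + 1) / (t - 1) ≤ Real.exp (2 / (t - 1)) := by
      refine le_trans (le_of_eq ?_) (Real.add_one_le_exp _)
      field_simp; ring
    calc ((t + 1) / (t - 1)) ^ k ≤ Real.exp (2 / (t - 1)) ^ k := by gcongr
      _ = Real.exp (2 * k / (t - 1)) := by rw [← Real.exp_nat_mul]; congr 1; ring

/-! ### The resisting oracle. -/

/-- Let `z` be the component of `y` orthogonal to `K`. The reflection negating `z - ‖z‖ • v` takes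
`z` to `‖z‖ • v`, and it fixes `K` because that vector is orthogonal to `K`. -/
theorem exists_isometry_into_sup_span {E : Type*} [NormedAddCommGroup E] [InnerProductSpace ℝ E]
    [FiniteDimensional ℝ E] (K : Submodule ℝ E) {v : E} (hv : ‖v‖ = 1) (hvK : v ∈ Kᗮ) (y : E) :
    ∃ R : E ≃ₗᵢ[ℝ] E, (∀ x ∈ K, R x = x) ∧ R y ∈ K ⊔ Submodule.span ℝ {v} := by
  obtain ⟨p, hp, z, hz, rfl⟩ := K.exists_add_mem_mem_orthogonal y
  have hw : z - ‖z‖ • v ∈ Kᗮ := Kᗮ.sub_mem hz (Kᗮ.smul_mem _ hvK)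
  have hfix : ∀ x ∈ K, (Submodule.span ℝ {z - ‖z‖ • v})ᗮ.reflection x = x := fun x hx =>
    Submodule.reflection_mem_subspace_eq_self (Submodule.mem_orthogonal_singleton_iff_inner_left.2
      (Submodule.inner_right_of_mem_orthogonal hx hw))
  refine ⟨(Submodule.span ℝ {z - ‖z‖ • v})ᗮ.reflection, hfix, ?_⟩
  rw [map_add, hfix p hp, Submodule.reflection_sub (by simp [norm_smul, hv])]
  exact Submodule.add_mem_sup hp (Submodule.smul_mem _ _ (Submodule.mem_span_singleton_self v))

theorem gradient_comp_linearIsometryEquiv {E : Type*} [NormedAddCommGroup E]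
    [InnerProductSpace ℝ E] [CompleteSpace E] (f : E → ℝ) (U : E ≃ₗᵢ[ℝ] E) (x : E) :
    gradient (f ∘ U.symm) x = U (gradient f (U.symm x)) := by
  refine ext_inner_right ℝ fun y => ?_
  have h : fderiv ℝ (f ∘ U.symm) x =
      (fderiv ℝ f (U.symm x)).comp (U.symm.toContinuousLinearEquiv : E →L[ℝ] E) :=
    U.symm.toContinuousLinearEquiv.comp_right_fderiv
  rw [inner_gradient_left, h, LinearIsometryEquiv.inner_map_eq_flip, inner_gradient_left]
  rfl

/-- A resisting oracle: by rotating `f`, the `k`-th iterate can be forced into `P k`. -/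
theorem exists_isometry_forall_iterate_mem {d : ℕ} (M : FirstOrderMethod d)
    (f : EuclideanSpace ℝ (Fin d) → ℝ) (P G : ℕ → Submodule ℝ (EuclideanSpace ℝ (Fin d)))
    (v : ℕ → EuclideanSpace ℝ (Fin d)) (N : ℕ)
    (hPG : ∀ k < N, P k ≤ G k) (hgrad : ∀ k < N, ∀ x ∈ P k, gradient f x ∈ G k)
    (hv : ∀ k < N, ‖v k‖ = 1) (hvG : ∀ k < N, v k ∈ (G k)ᗮ)
    (hGP : ∀ k < N, G k ⊔ Submodule.span ℝ {v k} ≤ P (k + 1)) :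
    ∃ U : EuclideanSpace ℝ (Fin d) ≃ₗᵢ[ℝ] EuclideanSpace ℝ (Fin d),
      ∀ j ≤ N, U.symm (M.iterate (f ∘ U.symm) j) ∈ P j := by
  suffices H : ∀ k ≤ N, ∃ U : EuclideanSpace ℝ (Fin d) ≃ₗᵢ[ℝ] EuclideanSpace ℝ (Fin d),
      ∀ j ≤ k, U.symm (M.iterate (f ∘ U.symm) j) ∈ P j from H N le_rfl
  have hmono : ∀ i k, i ≤ k → k < N → G i ≤ G k := by
    intro i k hik
    induction k, hik using Nat.le_induction with
    | base => exact fun _ => le_rfl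
    | succ k _ ih =>
      exact fun hk => (ih (by omega)).trans
        ((le_sup_left.trans (hGP k (by omega))).trans (hPG _ hk))
  intro k
  induction k with
  | zero =>
    refine fun _ => ⟨LinearIsometryEquiv.refl ℝ _, fun j hj => ?_⟩
    obtain rfl : j = 0 := by omega
    rw [M.iterate_zero, map_zero]
    exact Submodule.zero_mem _
  | succ k ih =>
    intro hk
    obtain ⟨U, hU⟩ := ih (by omega)
    obtain ⟨R, hR, hRy⟩ := exists_isometry_into_sup_span (G k) (hv k hk) (hvG k hk)
      (U.symm (M.iterate (f ∘ U.symm) (k + 1)))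
    have hRs : ∀ x ∈ G k, R.symm x = x := fun x hx => by
      rw [LinearIsometryEquiv.symm_apply_eq, hR x hx]
    have hmem : ∀ j ≤ k, U.symm (M.iterate (f ∘ U.symm) j) ∈ G k := fun j hj =>
      hmono j k hj hk (hPG j (by omega) (hU j hj))
    -- The points queried so far, pulled back by `U`, and the gradients there lie in `G k`, which
    -- `R` fixes. The oracle answers up to index `k` are therefore unchanged, and so is the iterate
    -- `k + 1` computed from them.
    have hsame : ∀ j ≤ k + 1,
        M.iterate (f ∘ (R.symm.trans U).symm) j = M.iterate (f ∘ U.symm) j := by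
      intro j
      induction j using Nat.strong_induction_on with
      | _ j ihj =>
        intro hj
        cases j with
        | zero => rw [M.iterate_zero, M.iterate_zero]
        | succ j =>
          rw [M.iterate_succ, M.iterate_succ]
          congr 1
          funext i
          have hi : (i : ℕ) ≤ k := by omega
          rw [ihj i (by omega) (by omega)]
          have hx : (R.symm.trans U).symm (M.iterate (f ∘ U.symm) i) =
              U.symm (M.iterate (f ∘ U.symm) i) := hR _ (hmem i hi)
          refine Prod.ext ?_ ?_
          · change f ((R.symm.trans U).symm _) = f (U.symm _)
            rw [hx]
          · change gradient _ _ = gradient _ _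
            rw [gradient_comp_linearIsometryEquiv, gradient_comp_linearIsometryEquiv, hx]
            change U (R.symm _) = _
            rw [hRs _ (hmono i k hi hk (hgrad i (by omega) _ (hU i hi)))]
    refine ⟨R.symm.trans U, fun j hj => ?_⟩
    rw [hsame j hj]
    rcases Nat.lt_or_ge k j with h | h
    · obtain rfl : j = k + 1 := by omega
      exact hGP k hk hRy
    · change R (U.symm _) ∈ _
      rw [hR _ (hmem j h)]
      exact hU j h

/-! ### Calculus of the regularized quadratic and its rotations. -/

section RegularizedQuadratic

variable {d : ℕ} {A : Matrix (Fin d) (Fin d) ℝ} {b : EuclideanSpace ℝ (Fin d)} {s : ℝ}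

theorem Matrix.IsHermitian.inner_toEuclideanLin (hA : A.IsHermitian)
    (x y : EuclideanSpace ℝ (Fin d)) :
    inner ℝ (Matrix.toEuclideanLin A x) y = inner ℝ x (Matrix.toEuclideanLin A y) :=
  (Matrix.isSymmetric_toEuclideanLin_iff.2 hA) x y

theorem regQuadratic_add (hA : A.IsHermitian) (x e : EuclideanSpace ℝ (Fin d)) :
    regQuadratic A b s (x + e) = regQuadratic A b s x +
      inner ℝ (Matrix.toEuclideanLin A x - b + s • x) e +
      (1 / 2 * inner ℝ e (Matrix.toEuclideanLin A e) + s / 2 * ‖e‖ ^ 2) := by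
  have h1 : inner ℝ e (Matrix.toEuclideanLin A x) = inner ℝ (Matrix.toEuclideanLin A x) e :=
    real_inner_comm _ _
  have h2 : inner ℝ x (Matrix.toEuclideanLin A e) = inner ℝ (Matrix.toEuclideanLin A x) e :=
    (hA.inner_toEuclideanLin x e).symm
  simp only [regQuadratic, map_add, inner_add_left, inner_add_right, inner_sub_left,
    real_inner_smul_left, norm_add_sq_real, h1, h2]
  ring

theorem gradient_regQuadratic (hA : A.IsHermitian) (x : EuclideanSpace ℝ (Fin d)) :
    gradient (regQuadratic A b s) x = Matrix.toEuclideanLin A x - b + s • x := by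
  refine HasGradientAt.gradient ?_
  rw [hasGradientAt_iff_isLittleO]
  have hquad : ∀ y, regQuadratic A b s y - regQuadratic A b s x -
      inner ℝ (Matrix.toEuclideanLin A x - b + s • x) (y - x) =
      1 / 2 * inner ℝ (y - x) (Matrix.toEuclideanLin A (y - x)) + s / 2 * ‖y - x‖ ^ 2 := by
    intro y
    have := regQuadratic_add (b := b) (s := s) hA x (y - x)
    rw [add_sub_cancel] at this
    linarith
  simp only [hquad]
  refine Asymptotics.IsBigO.trans_isLittleO (g := fun y => ‖y - x‖ ^ 2) ?_ ?_
  · refine Asymptotics.IsBigO.of_bound (1 / 2 * ‖Matrix.toEuclideanCLM (𝕜 := ℝ) A‖ + |s| / 2)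
      (Filter.Eventually.of_forall fun y => ?_)
    have h1 : |inner ℝ (y - x) (Matrix.toEuclideanLin A (y - x))| ≤
        ‖Matrix.toEuclideanCLM (𝕜 := ℝ) A‖ * ‖y - x‖ ^ 2 := by
      refine (abs_real_inner_le_norm _ _).trans ?_
      have := (Matrix.toEuclideanCLM (𝕜 := ℝ) A).le_opNorm (y - x)
      calc _ ≤ ‖y - x‖ * (‖Matrix.toEuclideanCLM (𝕜 := ℝ) A‖ * ‖y - x‖) := by gcongr; exact this
        _ = _ := by ring
    rw [Real.norm_eq_abs, Real.norm_eq_abs, abs_of_nonneg (sq_nonneg ‖y - x‖)]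
    refine (abs_add_le _ _).trans ?_
    have h2 : |(1 : ℝ) / 2| = 1 / 2 := by norm_num
    have h3 : |s / 2| = |s| / 2 := by rw [abs_div, abs_two]
    rw [abs_mul, abs_mul, h2, h3, abs_of_nonneg (sq_nonneg ‖y - x‖)]
    linarith
  · have := (Asymptotics.isLittleO_pow_id (𝕜 := ℝ) (n := 2) (by norm_num)).comp_tendsto
      (tendsto_norm_sub_self x)
    exact this.of_norm_right.congr_left fun _ => rfl

theorem regQuadratic_sub_of_stationary (hA : A.IsHermitian) {x : EuclideanSpace ℝ (Fin d)}
    (hx : Matrix.toEuclideanLin A x + s • x = b) (y : EuclideanSpace ℝ (Fin d)) :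
    regQuadratic A b s y - regQuadratic A b s x =
      1 / 2 * inner ℝ (y - x) (Matrix.toEuclideanLin A (y - x)) + s / 2 * ‖y - x‖ ^ 2 := by
  have h := regQuadratic_add (b := b) (s := s) hA x (y - x)
  have h0 : Matrix.toEuclideanLin A x - b + s • x = 0 := by rw [← hx]; abel
  rw [add_sub_cancel, h0, inner_zero_left] at h
  linarith

theorem Matrix.PosSemidef.inner_toEuclideanLin_nonneg (hA : A.PosSemidef)
    (x : EuclideanSpace ℝ (Fin d)) : 0 ≤ inner ℝ x (Matrix.toEuclideanLin A x) := by
  have := hA.dotProduct_mulVec_nonneg x.ofLp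
  rw [EuclideanSpace.inner_eq_star_dotProduct, dotProduct_comm]
  simpa using this

theorem regQuadratic_lt_of_stationary (hA : A.PosSemidef) (hs : 0 < s)
    {x y : EuclideanSpace ℝ (Fin d)} (hx : Matrix.toEuclideanLin A x + s • x = b) (hy : y ≠ x) :
    regQuadratic A b s x < regQuadratic A b s y := by
  have h := regQuadratic_sub_of_stationary hA.isHermitian hx y
  have h1 := hA.inner_toEuclideanLin_nonneg (y - x)
  have h2 : 0 < s / 2 * ‖y - x‖ ^ 2 := by
    have : 0 < ‖y - x‖ := norm_pos_iff.2 (sub_ne_zero.2 hy)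
    positivity
  linarith

theorem strongConvexOn_regQuadratic (hA : A.PosSemidef) :
    StrongConvexOn Set.univ s (regQuadratic A b s) := by
  rw [strongConvexOn_iff_convex]
  refine ⟨convex_univ, fun x _ y _ α β hα hβ hαβ => ?_⟩
  have h1 := hA.inner_toEuclideanLin_nonneg (x - y)
  have hxy : inner ℝ x (Matrix.toEuclideanLin A y) = inner ℝ y (Matrix.toEuclideanLin A x) := by
    rw [← hA.isHermitian.inner_toEuclideanLin, real_inner_comm]
  obtain rfl : β = 1 - α := by linarith
  simp only [regQuadratic, map_add, map_sub, map_smul, inner_add_left, inner_add_right,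
    inner_sub_left, inner_sub_right, real_inner_smul_left, real_inner_smul_right, hxy,
    smul_eq_mul] at h1 ⊢
  nlinarith [mul_nonneg (mul_nonneg hα hβ) h1]

/-- The matrix of the operator `A` transported by the isometry `U`. -/
noncomputable def Matrix.conjIsometry (A : Matrix (Fin d) (Fin d) ℝ)
    (U : EuclideanSpace ℝ (Fin d) ≃ₗᵢ[ℝ] EuclideanSpace ℝ (Fin d)) : Matrix (Fin d) (Fin d) ℝ :=
  (Matrix.toEuclideanCLM (𝕜 := ℝ)).symm (U.conjStarAlgEquiv (Matrix.toEuclideanCLM (𝕜 := ℝ) A))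

variable (U : EuclideanSpace ℝ (Fin d) ≃ₗᵢ[ℝ] EuclideanSpace ℝ (Fin d))

theorem Matrix.toEuclideanLin_conjIsometry (x : EuclideanSpace ℝ (Fin d)) :
    Matrix.toEuclideanLin (A.conjIsometry U) x = U (Matrix.toEuclideanLin A (U.symm x)) := by
  change Matrix.toEuclideanCLM (𝕜 := ℝ) (A.conjIsometry U) x = _
  rw [Matrix.conjIsometry, StarAlgEquiv.apply_symm_apply]
  rfl

theorem Matrix.spectrum_conjIsometry : spectrum ℝ (A.conjIsometry U) = spectrum ℝ A := by
  rw [Matrix.conjIsometry, AlgEquiv.spectrum_eq, AlgEquiv.spectrum_eq, AlgEquiv.spectrum_eq]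

theorem Matrix.PosSemidef.conjIsometry (hA : A.PosSemidef) : (A.conjIsometry U).PosSemidef := by
  have hH : (A.conjIsometry U).IsHermitian := by
    refine Matrix.isSymmetric_toEuclideanLin_iff.1 fun x y => ?_
    rw [Matrix.toEuclideanLin_conjIsometry, Matrix.toEuclideanLin_conjIsometry,
      LinearIsometryEquiv.inner_map_eq_flip, hA.isHermitian.inner_toEuclideanLin,
      LinearIsometryEquiv.inner_map_eq_flip, LinearIsometryEquiv.symm_symm]
  refine Matrix.PosSemidef.of_dotProduct_mulVec_nonneg hH fun x => ?_
  have h := hA.inner_toEuclideanLin_nonneg (U.symm (WithLp.toLp 2 x))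
  rw [← LinearIsometryEquiv.inner_map_map U, LinearIsometryEquiv.apply_symm_apply,
    ← Matrix.toEuclideanLin_conjIsometry, EuclideanSpace.inner_eq_star_dotProduct,
    dotProduct_comm] at h
  simpa using h

theorem regQuadratic_conjIsometry :
    regQuadratic (A.conjIsometry U) (U b) s = regQuadratic A b s ∘ U.symm := by
  funext x
  simp only [regQuadratic, Function.comp, Matrix.toEuclideanLin_conjIsometry,
    LinearIsometryEquiv.norm_map]
  rw [← LinearIsometryEquiv.inner_map_map U (U.symm x), ← LinearIsometryEquiv.inner_map_map U b,
    LinearIsometryEquiv.apply_symm_apply]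

end RegularizedQuadratic

/-! ### Diagonal Hessians and their Krylov subspaces. -/

section Diagonal

variable {d : ℕ} {h : Fin d → ℝ} {s : ℝ}

theorem toEuclideanLin_diagonal_apply (δ : Fin d → ℝ) (x : EuclideanSpace ℝ (Fin d)) (i : Fin d) :
    Matrix.toEuclideanLin (Matrix.diagonal δ) x i = δ i * x i := by
  simp [Matrix.toLpLin_apply, Matrix.mulVec_diagonal]

theorem toEuclideanLin_diagonal_sub_const_add (x : EuclideanSpace ℝ (Fin d)) :
    Matrix.toEuclideanLin (Matrix.diagonal fun i => h i - s) x + s • x =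
      WithLp.toLp 2 fun i => h i * x i := by
  ext i
  simp only [PiLp.add_apply, PiLp.smul_apply, toEuclideanLin_diagonal_apply, smul_eq_mul]
  ring

theorem gradient_regQuadratic_diagonal (b y : EuclideanSpace ℝ (Fin d)) :
    gradient (regQuadratic (Matrix.diagonal fun i => h i - s) b s) y =
      WithLp.toLp 2 (fun i => h i * y i) - b := by
  rw [gradient_regQuadratic (Matrix.isHermitian_diagonal _),
    ← toEuclideanLin_diagonal_sub_const_add (s := s)]
  abel

theorem regQuadratic_diagonal_sub (z y : EuclideanSpace ℝ (Fin d)) :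
    regQuadratic (Matrix.diagonal fun i => h i - s) (WithLp.toLp 2 fun i => h i * z i) s y -
      regQuadratic (Matrix.diagonal fun i => h i - s) (WithLp.toLp 2 fun i => h i * z i) s z =
      1 / 2 * ∑ i, h i * (y i - z i) ^ 2 := by
  rw [regQuadratic_sub_of_stationary (Matrix.isHermitian_diagonal _)
    (toEuclideanLin_diagonal_sub_const_add z)]
  have h1 : inner ℝ (y - z) (Matrix.toEuclideanLin (Matrix.diagonal fun i => h i - s) (y - z)) =
      ∑ i, (h i - s) * (y i - z i) ^ 2 := by
    rw [PiLp.inner_apply]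
    refine Finset.sum_congr rfl fun i _ => ?_
    rw [toEuclideanLin_diagonal_apply]
    simp only [PiLp.sub_apply, RCLike.inner_apply, conj_trivial]
    ring
  rw [h1, EuclideanSpace.real_norm_sq_eq, Finset.mul_sum, Finset.mul_sum, Finset.mul_sum,
    ← Finset.sum_add_distrib]
  refine Finset.sum_congr rfl fun i _ => ?_
  simp only [PiLp.sub_apply]
  ring

/-- Polyak–Łojasiewicz inequality: coordinatewise it is `m * h i ≤ h i ^ 2`. -/
theorem two_mul_gap_le_norm_gradient_sq {m : ℝ} (hm : 0 ≤ m) (hh : ∀ i, m ≤ h i)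
    (z y : EuclideanSpace ℝ (Fin d)) :
    2 * m * (regQuadratic (Matrix.diagonal fun i => h i - s) (WithLp.toLp 2 fun i => h i * z i) s y -
      regQuadratic (Matrix.diagonal fun i => h i - s) (WithLp.toLp 2 fun i => h i * z i) s z) ≤
    ‖gradient (regQuadratic (Matrix.diagonal fun i => h i - s)
      (WithLp.toLp 2 fun i => h i * z i) s) y‖ ^ 2 := by
  rw [regQuadratic_diagonal_sub, gradient_regQuadratic_diagonal, EuclideanSpace.real_norm_sq_eq,
    Finset.mul_sum, Finset.mul_sum]
  refine Finset.sum_le_sum fun i _ => ?_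
  simp only [PiLp.sub_apply]
  have := mul_le_mul_of_nonneg_right (hh i) (mul_nonneg (hm.trans (hh i)) (sq_nonneg (y i - z i)))
  nlinarith

/-- The vector `p(H) b` for the diagonal operator `H` with entries `h`. -/
noncomputable def diagonalAeval (h : Fin d → ℝ) (b : EuclideanSpace ℝ (Fin d)) :
    ℝ[X] →ₗ[ℝ] EuclideanSpace ℝ (Fin d) where
  toFun p := WithLp.toLp 2 fun i => p.eval (h i) * b i
  map_add' p q := by ext i; simp [add_mul]
  map_smul' c p := by ext i; simp [mul_assoc]

theorem diagonalAeval_apply (b : EuclideanSpace ℝ (Fin d)) (p : ℝ[X]) (i : Fin d) :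
    diagonalAeval h b p i = p.eval (h i) * b i := rfl

/-- The Krylov subspace of order `j` of the diagonal operator with entries `h`. -/
noncomputable def diagonalKrylov (h : Fin d → ℝ) (b : EuclideanSpace ℝ (Fin d)) (j : ℕ) :
    Submodule ℝ (EuclideanSpace ℝ (Fin d)) :=
  (degreeLT ℝ j).map (diagonalAeval h b)

variable {b : EuclideanSpace ℝ (Fin d)}

theorem mem_diagonalKrylov {j : ℕ} {x : EuclideanSpace ℝ (Fin d)} :
    x ∈ diagonalKrylov h b j ↔ ∃ p : ℝ[X], p.degree < j ∧ diagonalAeval h b p = x := by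
  simp [diagonalKrylov, Submodule.mem_map, mem_degreeLT]

theorem diagonalKrylov_mono : Monotone (diagonalKrylov h b) :=
  fun _ _ hij => Submodule.map_mono (degreeLT_mono hij)

theorem gradient_mem_diagonalKrylov {j : ℕ} {x : EuclideanSpace ℝ (Fin d)}
    (hx : x ∈ diagonalKrylov h b j) :
    gradient (regQuadratic (Matrix.diagonal fun i => h i - s) b s) x ∈
      diagonalKrylov h b (j + 1) := by
  obtain ⟨p, hp, rfl⟩ := mem_diagonalKrylov.1 hx
  rw [gradient_regQuadratic_diagonal, mem_diagonalKrylov]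
  refine ⟨X * p - 1, ?_, ?_⟩
  · refine (degree_sub_le _ _).trans_lt (max_lt ?_ ?_)
    · by_cases h0 : p = 0
      · subst h0; rw [mul_zero, degree_zero]; exact WithBot.bot_lt_coe _
      · rw [degree_eq_natDegree h0] at hp
        rw [degree_mul, degree_X, degree_eq_natDegree h0]
        have : p.natDegree < j := by exact_mod_cast hp
        exact_mod_cast (by omega : 1 + p.natDegree < j + 1)
    · rw [degree_one]; exact_mod_cast Nat.succ_pos j
  · ext i
    simp only [diagonalAeval_apply, PiLp.sub_apply, eval_sub, eval_mul, eval_X, eval_one]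
    ring

/-- As long as more than `j` distinct entries of `h` are active in `b`, the Krylov subspaces grow. -/
theorem diagonalAeval_X_pow_notMem {j : ℕ} (S : Finset (Fin d)) (hinj : Set.InjOn h S)
    (hb : ∀ i ∈ S, b i ≠ 0) (hS : j < S.card) :
    diagonalAeval h b (X ^ j) ∉ diagonalKrylov h b j := by
  intro hmem
  obtain ⟨p, hp, hpx⟩ := mem_diagonalKrylov.1 hmem
  have hdeg : (X ^ j - p : ℝ[X]).degree = (j : WithBot ℕ) := by
    rw [degree_sub_eq_left_of_degree_lt (by rwa [degree_X_pow]), degree_X_pow]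
  have h0 : X ^ j - p = 0 := by
    refine eq_zero_of_degree_lt_of_eval_index_eq_zero S hinj ?_ fun i hi => ?_
    · rw [hdeg]; exact_mod_cast hS
    · have := congrArg (fun x : EuclideanSpace ℝ (Fin d) => x i) hpx
      simp only [diagonalAeval_apply] at this
      rw [eval_sub, mul_right_cancel₀ (hb i hi) this, sub_self]
  rw [h0, degree_zero] at hdeg
  exact absurd hdeg (by simp)

end Diagonal

/-! ### The hard instance. -/

theorem exists_unit_mem_orthogonal {E : Type*} [NormedAddCommGroup E] [InnerProductSpace ℝ E]
    [FiniteDimensional ℝ E] {K K' : Submodule ℝ E} (hK : K ≤ K') {x : E} (hx : x ∈ K')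
    (hxK : x ∉ K) : ∃ v ∈ K', ‖v‖ = 1 ∧ v ∈ Kᗮ := by
  obtain ⟨p, hp, z, hz, rfl⟩ := K.exists_add_mem_mem_orthogonal x
  have hz0 : z ≠ 0 := by
    rintro rfl
    exact hxK (by simpa using hp)
  refine ⟨‖z‖⁻¹ • z, K'.smul_mem _ ?_, norm_smul_inv_norm hz0, Kᗮ.smul_mem _ hz⟩
  simpa using K'.sub_mem hx (hK hp)

/-- A weighted `ℓ²` lower bound dual to an extrapolation inequality. -/
theorem sq_div_le_sum_weight_mul_sq {ι : Type*} (t : Finset ι) {a T : ℝ} {c lam g : ι → ℝ}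
    (ha : 0 ≤ a) (hlam : ∀ i ∈ t, a ≤ lam i) (hc : ∀ i ∈ t, 0 ≤ c i)
    (hg : 1 ≤ ∑ i ∈ t, c i * |g i|) (hT : ∑ i ∈ t, c i ≤ T) (hpos : 0 < ∑ i ∈ t, c i) :
    a / T ^ 2 ≤ ∑ i ∈ t, lam i * (c i / ∑ j ∈ t, c j) * g i ^ 2 := by
  set S := ∑ i ∈ t, c i with hS
  have hCS : 1 ≤ S * ∑ i ∈ t, c i * g i ^ 2 := by
    have h := Finset.sum_mul_sq_le_sq_mul_sq t (fun i => Real.sqrt (c i))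
      (fun i => Real.sqrt (c i) * |g i|)
    have e1 : ∑ i ∈ t, Real.sqrt (c i) * (Real.sqrt (c i) * |g i|) = ∑ i ∈ t, c i * |g i| :=
      Finset.sum_congr rfl fun i hi => by rw [← mul_assoc, Real.mul_self_sqrt (hc i hi)]
    have e2 : ∑ i ∈ t, Real.sqrt (c i) ^ 2 = S :=
      Finset.sum_congr rfl fun i hi => Real.sq_sqrt (hc i hi)
    have e3 : ∑ i ∈ t, (Real.sqrt (c i) * |g i|) ^ 2 = ∑ i ∈ t, c i * g i ^ 2 :=
      Finset.sum_congr rfl fun i hi => by rw [mul_pow, Real.sq_sqrt (hc i hi), sq_abs]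
    rw [e1, e2, e3] at h
    exact (one_le_pow₀ hg).trans h
  have hTpos : 0 < T := hpos.trans_le hT
  calc a / T ^ 2 ≤ a / S ^ 2 := by gcongr
    _ ≤ a / S * ∑ i ∈ t, c i * g i ^ 2 := by
      rw [show a / S ^ 2 = a / S * (1 / S) by field_simp]
      gcongr
      rw [div_le_iff₀ hpos]; linarith
    _ = ∑ i ∈ t, a * (c i / S) * g i ^ 2 := by
      rw [Finset.mul_sum]; exact Finset.sum_congr rfl fun i _ => by ring
    _ ≤ ∑ i ∈ t, lam i * (c i / S) * g i ^ 2 := by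
      refine Finset.sum_le_sum fun i hi => ?_
      have := hc i hi
      have := hlam i hi
      gcongr

/-- After rotating a diagonal quadratic, the `N`-th iterate of any method lies in the Krylov subspace
of order `2 * N - 1`, up to a component along an eigenvector that is inactive in `b`. -/
theorem exists_isometry_iterate_eq {d N : ℕ} (M : FirstOrderMethod d) (hN : 1 ≤ N) (s : ℝ)
    (h : Fin d → ℝ) (b : EuclideanSpace ℝ (Fin d)) (S : Finset (Fin d)) (hinj : Set.InjOn h S)
    (hb : ∀ i ∈ S, b i ≠ 0) (hS : 2 * N - 2 ≤ S.card) (i₀ : Fin d) (hi₀ : b i₀ = 0) :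
    ∃ (U : EuclideanSpace ℝ (Fin d) ≃ₗᵢ[ℝ] EuclideanSpace ℝ (Fin d)) (p : ℝ[X]) (c : ℝ),
      p.degree < (2 * N - 1 : ℕ) ∧
      U.symm (M.iterate (regQuadratic (Matrix.diagonal fun i => h i - s) b s ∘ U.symm) N) =
        diagonalAeval h b p + c • EuclideanSpace.single i₀ 1 := by
  have hex : ∀ k, ∃ v : EuclideanSpace ℝ (Fin d), k < N → ‖v‖ = 1 ∧
      v ∈ (diagonalKrylov h b (2 * k + 1))ᗮ ∧ (k + 1 < N → v ∈ diagonalKrylov h b (2 * k + 2)) ∧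
      (k + 1 = N → v = EuclideanSpace.single i₀ 1) := by
    intro k
    rcases lt_trichotomy (k + 1) N with hk | hk | hk
    -- Before the last step the new direction is taken inside the next Krylov subspace, so that the
    -- iterates remain polynomial in `H`.
    · have hx : diagonalAeval h b (X ^ (2 * k + 1)) ∈ diagonalKrylov h b (2 * k + 2) := by
        refine mem_diagonalKrylov.2 ⟨_, ?_, rfl⟩
        rw [degree_X_pow]
        exact_mod_cast Nat.lt_succ_self _
      obtain ⟨v, hv, hv1, hvo⟩ := exists_unit_mem_orthogonal (diagonalKrylov_mono (Nat.le_succ _)) hx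
        (diagonalAeval_X_pow_notMem S hinj hb (by omega))
      exact ⟨v, fun _ => ⟨hv1, hvo, fun _ => hv, fun h => absurd h hk.ne⟩⟩
    · refine ⟨EuclideanSpace.single i₀ 1, fun _ => ⟨by simp, ?_, fun h => absurd hk h.ne,
        fun _ => rfl⟩⟩
      rw [Submodule.mem_orthogonal]
      intro u hu
      obtain ⟨p, -, rfl⟩ := mem_diagonalKrylov.1 hu
      simp [EuclideanSpace.inner_single_right, diagonalAeval_apply, hi₀]
    · exact ⟨0, fun h => absurd h (by omega)⟩
  choose v hv using hex
  let G : ℕ → Submodule ℝ (EuclideanSpace ℝ (Fin d)) := fun k => diagonalKrylov h b (2 * k + 1)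
  let P : ℕ → Submodule ℝ (EuclideanSpace ℝ (Fin d)) := fun k =>
    Nat.casesOn k ⊥ fun j => G j ⊔ Submodule.span ℝ {v j}
  have hP : ∀ k < N, P k ≤ diagonalKrylov h b (2 * k) := by
    intro k hk
    cases k with
    | zero => exact bot_le
    | succ k =>
      refine sup_le (diagonalKrylov_mono (by omega)) ?_
      rw [Submodule.span_singleton_le_iff_mem]
      exact (hv k (by omega)).2.2.1 hk
  obtain ⟨U, hU⟩ := exists_isometry_forall_iterate_mem M
    (regQuadratic (Matrix.diagonal fun i => h i - s) b s) P G v N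
    (fun k hk => (hP k hk).trans (diagonalKrylov_mono (Nat.le_succ _)))
    (fun k hk x hx => gradient_mem_diagonalKrylov (hP k hk hx))
    (fun k hk => (hv k hk).1) (fun k hk => (hv k hk).2.1) (fun k _ => le_rfl)
  have hmem := hU N le_rfl
  obtain ⟨n, rfl⟩ : ∃ n, N = n + 1 := ⟨N - 1, by omega⟩
  obtain ⟨y, hy, w, hw, hyw⟩ := Submodule.mem_sup.1 hmem
  obtain ⟨p, hp, rfl⟩ := mem_diagonalKrylov.1 hy
  obtain ⟨c, rfl⟩ := Submodule.mem_span_singleton.1 hw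
  refine ⟨U, p, c, hp, ?_⟩
  rw [← hyw, (hv n (Nat.lt_succ_self n)).2.2.2 rfl]

/-- The left end `a` of the node interval is free, and it is chosen to gain the factor 2 that
offsets the `1 / 2` in the gap. -/
theorem exists_left_endpoint {m M : ℝ} (hm : 0 < m) (hM : m < M) {N : ℕ} (hN : 1 ≤ N) :
    ∃ a, m ≤ a ∧ a < M ∧ 2 * m * Real.exp (-(16 * (N : ℝ) / (Real.sqrt (M / m) - 1))) ≤
      a / Real.exp (2 * (2 * N - 1 : ℕ) / (Real.sqrt (M / a) - 1)) ^ 2 := by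
  have hk : ((2 * N - 1 : ℕ) : ℝ) = 2 * N - 1 := by
    rw [Nat.cast_sub (by omega)]; push_cast; ring
  have hN1 : (1 : ℝ) ≤ N := by exact_mod_cast hN
  have hsq : ∀ x : ℝ, Real.exp x ^ 2 = Real.exp (2 * x) := fun x => by
    rw [← Real.exp_nat_mul]; norm_num
  rw [hk]
  simp only [hsq, div_eq_mul_inv (_ : ℝ) (Real.exp _), ← Real.exp_neg]
  set t := Real.sqrt (M / m) with ht
  have ht1 : 1 < t := by
    rw [ht, Real.lt_sqrt (by norm_num), one_pow, lt_div_iff₀ hm]; linarith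
  -- For large `t` the choice `a = 2 * m` gives the factor directly, and `√(M / (2 * m)) ≥ (t + 1) /
  -- 2` at most doubles the exponent. For small `t` the choice `a = m` leaves a surplus `exp ((8 * N
  -- + 4) / (t - 1)) ≥ 2`.
  rcases le_or_gt (5 / 2) t with h | h
  · have hMt : M = m * t ^ 2 := by
      rw [ht, Real.sq_sqrt (div_nonneg (hm.trans hM).le hm.le)]; field_simp
    refine ⟨2 * m, by linarith, ?_, ?_⟩
    · have : 2 < t ^ 2 := by nlinarith
      nlinarith
    gcongr
    set u := Real.sqrt (M / (2 * m)) with hu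
    have hu1 : (t + 1) / 2 ≤ u := by
      rw [hu]
      apply Real.le_sqrt_of_sq_le
      rw [le_div_iff₀ (by positivity), hMt]
      have : (t + 1) ^ 2 ≤ 2 * t ^ 2 := by nlinarith
      nlinarith
    have hu2 : 0 < u - 1 := by linarith
    rw [← mul_div_assoc, div_le_div_iff₀ hu2 (by linarith)]
    nlinarith
  · refine ⟨m, le_rfl, hM, ?_⟩
    have h2 : (2 : ℝ) ≤ Real.exp ((8 * N + 4) / (t - 1)) := by
      have h3 : 1 ≤ (8 * (N : ℝ) + 4) / (t - 1) := by
        rw [le_div_iff₀ (by linarith)]; linarith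
      linarith [Real.add_one_le_exp ((8 * (N : ℝ) + 4) / (t - 1))]
    have h4 : Real.exp (-(2 * (2 * (2 * (N : ℝ) - 1) / (t - 1)))) =
        Real.exp ((8 * N + 4) / (t - 1)) * Real.exp (-(16 * N / (t - 1))) := by
      rw [← Real.exp_add]; congr 1; ring
    rw [h4, mul_comm 2 m, mul_assoc]
    gcongr

/-- A diagonal Hessian with spectrum in `[m, K]` and a rotation of it that is hard for `M`. -/
theorem exists_diagonal_instance {d N : ℕ} {m K s r : ℝ} (hm : 0 < m) (hK : m < K) (hr : 0 < r)
    (hN : 1 ≤ N) (hNd : 2 * N + 1 ≤ d) (M : FirstOrderMethod d) :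
    ∃ (h : Fin d → ℝ) (z : EuclideanSpace ℝ (Fin d))
      (U : EuclideanSpace ℝ (Fin d) ≃ₗᵢ[ℝ] EuclideanSpace ℝ (Fin d)),
      (∀ i, m ≤ h i) ∧ (∀ i, h i ≤ K) ∧ (∃ i, h i = m) ∧ (∃ i, h i = K) ∧ ‖z‖ = r ∧
      m * r ^ 2 * Real.exp (-(16 * (N : ℝ) / (Real.sqrt (K / m) - 1))) ≤
        1 / 2 * ∑ i, h i * (U.symm (M.iterate (regQuadratic (Matrix.diagonal fun i => h i - s)
          (WithLp.toLp 2 fun i => h i * z i) s ∘ U.symm) N) i - z i) ^ 2 := by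
  obtain ⟨a, hma, haK, hexp⟩ := exists_left_endpoint hm hK hN
  obtain ⟨lam, c, hinj, hlam, hlast, hc, hext, hT⟩ :=
    exists_extrapolation_nodes (hm.trans_le hma) haK (k := 2 * N - 1) (by omega)
  rw [show 2 * N - 1 + 1 = 2 * N by omega] at hinj hext hT
  set S := ∑ i ∈ Finset.range (2 * N), c i with hSdef
  have hcpos : ∀ i ∈ Finset.range (2 * N), 0 < c i := fun i hi =>
    hc i (by have := Finset.mem_range.1 hi; omega)
  have hSpos : 0 < S := Finset.sum_pos hcpos ⟨0, Finset.mem_range.2 (by omega)⟩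
  have hsum : ∀ F : ℕ → ℝ, ∑ i : Fin d, (if (i : ℕ) < 2 * N then F i else 0) =
      ∑ i ∈ Finset.range (2 * N), F i := by
    intro F
    rw [Fin.sum_univ_eq_sum_range (fun i => if i < 2 * N then F i else 0) d,
      ← Finset.sum_filter]
    congr 1
    ext i
    simp only [Finset.mem_filter, Finset.mem_range]
    omega
  -- The coordinates from `2 * N` on are inactive. They supply both the eigenvalue `m`, which need
  -- not be a node, and the direction for the last iterate.
  let h : Fin d → ℝ := fun i => if (i : ℕ) < 2 * N then lam i else m
  let z : EuclideanSpace ℝ (Fin d) :=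
    WithLp.toLp 2 fun i => if (i : ℕ) < 2 * N then r * Real.sqrt (c i / S) else 0
  have hz : ∀ i : Fin d, z i = if (i : ℕ) < 2 * N then r * Real.sqrt (c i / S) else 0 :=
    fun _ => rfl
  have hzsq : ∀ i ∈ Finset.range (2 * N), (r * Real.sqrt (c i / S)) ^ 2 = r ^ 2 * (c i / S) :=
    fun i hi => by rw [mul_pow, Real.sq_sqrt (div_nonneg (hcpos i hi).le hSpos.le)]
  obtain ⟨U, p, κ, hp, hU⟩ := exists_isometry_iterate_eq M hN s h
    (WithLp.toLp 2 fun i => h i * z i) (Finset.univ.filter fun i : Fin d => (i : ℕ) < 2 * N)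
    (by
      intro i hi j hj hij
      have hi' : (i : ℕ) < 2 * N := by simpa using hi
      have hj' : (j : ℕ) < 2 * N := by simpa using hj
      simp only [h, if_pos hi', if_pos hj'] at hij
      exact Fin.ext (hinj (by simpa using hi') (by simpa using hj') hij))
    (by
      intro i hi
      have hi' : (i : ℕ) < 2 * N := by simpa using hi
      have h1 := hcpos i (Finset.mem_range.2 hi')
      have h2 : 0 < lam i := (hm.trans_le hma).trans_le (hlam i).1
      simp only [h, hz, if_pos hi']
      positivity)
    (by
      have := Fin.card_filter_val_lt (n := d) (m := 2 * N)
      rw [this]; omega)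
    ⟨2 * N, by omega⟩ (by simp [hz])
  refine ⟨h, z, U, ?_, ?_, ⟨⟨2 * N, by omega⟩, by simp [h]⟩,
    ⟨⟨2 * N - 1, by omega⟩, ?_⟩, ?_, ?_⟩
  · intro i
    simp only [h]
    split_ifs
    exacts [hma.trans (hlam i).1, le_rfl]
  · intro i
    simp only [h]
    split_ifs
    exacts [(hlam i).2, hK.le]
  · simp only [h]
    rw [if_pos (by omega), hlast]
  · have : ‖z‖ ^ 2 = r ^ 2 := by
      rw [EuclideanSpace.real_norm_sq_eq]
      simp only [hz, ite_pow]
      rw [zero_pow two_ne_zero, hsum fun i => (r * Real.sqrt (c i / S)) ^ 2,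
        Finset.sum_congr rfl hzsq, ← Finset.mul_sum, ← Finset.sum_div, div_self hSpos.ne', mul_one]
    exact (sq_eq_sq₀ (norm_nonneg z) hr.le).1 this
  · rw [hU]
    -- The residual polynomial has degree at most `2 * N - 1`, exactly what `2 * N` nodes can
    -- interpolate.
    have hdeg : (1 - X * p : ℝ[X]).natDegree ≤ 2 * N - 1 := by
      have h1 : p.natDegree ≤ 2 * N - 2 := by
        by_cases h0 : p = 0
        · simp [h0]
        · rw [degree_eq_natDegree h0] at hp
          have : p.natDegree < 2 * N - 1 := by exact_mod_cast hp
          omega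
      refine (natDegree_sub_le _ _).trans (max_le (by simp) (natDegree_mul_le.trans ?_))
      rw [natDegree_X]; omega
    have hg := hext _ hdeg
    rw [eval_sub, eval_one, eval_mul, eval_X, zero_mul, sub_zero, abs_one] at hg
    have hmain := sq_div_le_sum_weight_mul_sq (Finset.range (2 * N)) (hm.le.trans hma)
      (fun i _ => (hlam i).1) (fun i hi => (hcpos i hi).le) hg hT hSpos
    have hle : ∑ i ∈ Finset.range (2 * N), r ^ 2 *
        (lam i * (c i / S) * eval (lam i) (1 - X * p) ^ 2) ≤
        ∑ i, h i * ((diagonalAeval h (WithLp.toLp 2 fun i => h i * z i) p +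
          κ • EuclideanSpace.single ⟨2 * N, by omega⟩ (1 : ℝ) : EuclideanSpace ℝ (Fin d)) i -
            z i) ^ 2 := by
      rw [← hsum]
      refine Finset.sum_le_sum fun i _ => ?_
      split_ifs with hi
      · have hne : i ≠ ⟨2 * N, by omega⟩ := fun he => by simp [he] at hi
        have h1 := hzsq i (Finset.mem_range.2 hi)
        simp only [PiLp.add_apply, PiLp.smul_apply, diagonalAeval_apply, h, hz, if_pos hi,
          PiLp.single_apply, if_neg hne, eval_sub, eval_one, eval_mul, eval_X, smul_eq_mul,
          mul_zero, add_zero]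
        refine le_of_eq ?_
        calc _ = lam i * (r ^ 2 * (c i / S)) * (1 - lam i * eval (lam i) p) ^ 2 := by ring
          _ = _ := by rw [← h1]; ring
      -- Inactive coordinates, including the one carrying `κ`, can only increase the gap.
      · simp only [h, if_neg hi]
        positivity
    rw [← Finset.mul_sum] at hle
    have hfin := mul_le_mul_of_nonneg_left (hexp.trans hmain) (sq_nonneg r)
    linarith

theorem corollary3 (d N : ℕ) (μ L s r : ℝ)
    (hμ : 0 < μ) (hL : μ < L) (hs : 0 < s) (hr : 0 < r)
    (hN : 1 ≤ N) (hNd : (N : ℝ) ≤ ((d : ℝ) - 1) / 2)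
    (M : FirstOrderMethod d) :
    ∃ (A : Matrix (Fin d) (Fin d) ℝ) (b xstar : EuclideanSpace ℝ (Fin d)),
      A.PosSemidef ∧
      IsLeast (spectrum ℝ A) μ ∧
      IsGreatest (spectrum ℝ A) L ∧
      (∃ m : ℝ, 0 < m ∧ StrongConvexOn Set.univ m (regQuadratic A b s)) ∧
      (∀ y, y ≠ xstar → regQuadratic A b s xstar < regQuadratic A b s y) ∧
      ‖xstar‖ = r ∧
      regQuadratic A b s (M.iterate (regQuadratic A b s) N) - regQuadratic A b s xstar ≥
        s * r ^ 2 *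
          Real.exp (-(16 * (N : ℝ) / (Real.sqrt (modifiedConditionNumber μ L s) - 1))) ∧
      ‖gradient (regQuadratic A b s) (M.iterate (regQuadratic A b s) N)‖ ≥
        s * r * Real.exp (-(8 * (N : ℝ) / (Real.sqrt (modifiedConditionNumber μ L s) - 1))) := by
  have hd : 2 * N + 1 ≤ d := by
    have : (2 * N + 1 : ℝ) ≤ d := by linarith
    exact_mod_cast this
  obtain ⟨h, z, U, hm, hK, ⟨i, hi⟩, ⟨j, hj⟩, hz, hgap⟩ :=
    exists_diagonal_instance (s := s) (show 0 < μ + s by linarith)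
      (show μ + s < L + s by linarith) hr hN hd M
  rw [← regQuadratic_diagonal_sub, ← modifiedConditionNumber] at hgap
  have hgrad := (mul_le_mul_of_nonneg_left hgap (show 0 ≤ 2 * (μ + s) by linarith)).trans
    (two_mul_gap_le_norm_gradient_sq (s := s) (by linarith) hm z _)
  have hA : (Matrix.diagonal fun i => h i - s).PosSemidef :=
    Matrix.PosSemidef.diagonal fun i => by have := hm i; simp only [Pi.zero_apply]; linarith
  have hAU := hA.conjIsometry U
  have hstat : Matrix.toEuclideanLin ((Matrix.diagonal fun i => h i - s).conjIsometry U) (U z) +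
      s • U z = U (WithLp.toLp 2 fun i => h i * z i) := by
    rw [Matrix.toEuclideanLin_conjIsometry, LinearIsometryEquiv.symm_apply_apply, ← map_smul,
      ← map_add, toEuclideanLin_diagonal_sub_const_add]
  refine ⟨(Matrix.diagonal fun i => h i - s).conjIsometry U,
    U (WithLp.toLp 2 fun i => h i * z i), U z, hAU, ?_, ?_,
    ⟨s, hs, strongConvexOn_regQuadratic hAU⟩,
    fun y hy => regQuadratic_lt_of_stationary hAU hs hstat hy, ?_, ?_, ?_⟩
  · rw [Matrix.spectrum_conjIsometry, spectrum_diagonal]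
    refine ⟨⟨i, by simp only [hi]; ring⟩, ?_⟩
    rintro _ ⟨i, rfl⟩
    have := hm i
    simp only; linarith
  · rw [Matrix.spectrum_conjIsometry, spectrum_diagonal]
    refine ⟨⟨j, by simp only [hj]; ring⟩, ?_⟩
    rintro _ ⟨i, rfl⟩
    have := hK i
    simp only; linarith
  · rw [LinearIsometryEquiv.norm_map, hz]
  · rw [regQuadratic_conjIsometry]
    simp only [Function.comp_apply, LinearIsometryEquiv.symm_apply_apply]
    refine ge_iff_le.2 (le_trans ?_ hgap)
    gcongr
    linarith
  · rw [regQuadratic_conjIsometry, gradient_comp_linearIsometryEquiv,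
      LinearIsometryEquiv.norm_map]
    refine abs_le_of_sq_le_sq' ?_ (norm_nonneg _) |>.2
    refine le_trans ?_ hgrad
    have hexp : Real.exp (-(8 * (N : ℝ) / (Real.sqrt (modifiedConditionNumber μ L s) - 1))) ^ 2 =
        Real.exp (-(16 * (N : ℝ) / (Real.sqrt (modifiedConditionNumber μ L s) - 1))) := by
      rw [← Real.exp_nat_mul]; congr 1; push_cast; ring
    rw [mul_pow, mul_pow, hexp, ← mul_assoc, ← mul_assoc]
    gcongr
    nlinarith
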